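/- Let $\mathbb F$ be a field of characteristic different from $2$. A quadratic Lie algebra is a finite-dimensional Lie algebra $\mathfrak g$ over $\mathbb F$ with an invariant metric, i.e. a non-degenerate symmetric bilinear form $B$ such that $B(x,[y,z])=B([x,y],z)$ for all $x,y,z\in\mathfrak g$. It is indecomposable if the only ideals of $\mathfrak g$ on which $B$ is non-degenerate are $\{0\}$ and $\mathfrak g$. The nilradical $\operatorname{Nil}(\mathfrak g)$ is the sum of all ideals of $\mathfrak g$ that are nilpotent Lie algebras. Let $m\ge 1$, and let $V$ be a $2m$-dimensional vector space over $\mathbb F$ with a non-degenerate skew-symmetric bilinear form $\omega$. The Heisenberg Lie algebra is $\mathfrak h_m=V\oplus\mathbb F\hslash$ with $[u,v]=\omega(u,v)\hslash$ for $u,v\in V$ and $\hslash$ central. For an invertible linear map $\phi:V\to V$ with $\omega(\phi(u),v)=-\omega(u,\phi(v))$ for all $u,v \in V$, the Heisenberg Lie algebra extended by (the derivation) $\phi$ is the quadratic Lie algebra $\mathfrak h_m(\phi)=\mathbb F\phi\oplus V\oplus\mathbb F\hslash$ with $[\phi,u]=\phi(u)$, $[u,v]=\omega(u,v)\hslash$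 for $u,v\in V$ and $\hslash$ central, and with the invariant metric $B_\phi$ given by $B_\phi(u,v)=\omega(\phi^{-1}(u),v)$ for $u,v\in V$, $B_\phi(\phi,\hslash)=1$, and $B_\phi(u,\phi)=B_\phi(u,\hslash)=B_\phi(\phi,\phi)=B_\phi(\hslash,\hslash)=0$. Let $(\mathfrak g,B)$ be a quadratic Lie algebra over $\mathbb F$ such that $\operatorname{Nil}(\mathfrak g)$ is isomorphic to $\mathfrak h_m$. (i) If $\mathbb F$ has characteristic $0$ and $(\mathfrak g,B)$ is indecomposable, then $\mathfrak g$ is the Heisenberg Lie algebra extended by a derivation: there are a map $\phi$ as above and a Lie algebra isomorphism $e:\mathfrak g\to\mathfrak h_m(\phi)$ with $B_\phi(e(x),e(y))=B(x,y)$ for all $x,y\in\mathfrak g$. (ii) If $\mathfrak g$ is solvable, then $\mathfrak g$ is the Heisenberg Lie algebra extended by a derivation, in the same sense. -/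

import Mathlib

/-- The nilradical of a Lie algebra: the sum of all ideals that are nilpotent as Lie algebras.
(Mathlib's `LieAlgebra.maxNilpotentIdeal` is a different ideal: it asks for nilpotency of the
ideal as a module over the whole algebra.) -/
def lieNilradical (F L : Type*) [CommRing F] [LieRing L] [LieAlgebra F L] : LieIdeal F L :=
  sSup {I : LieIdeal F L | LieRing.IsNilpotent I}

/-- An invariant metric on a Lie algebra: a symmetric non-degenerate bilinear form `B` such that
`B x ⁅y, z⁆ = B ⁅x, y⁆ z`. A quadratic Lie algebra is a Lie algebra with such a form. -/
structure IsInvariantMetric {F L : Type*} [Field F] [LieRing L] [LieAlgebra F L]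
    (B : LinearMap.BilinForm F L) : Prop where
  symm : ∀ x y, B x y = B y x
  nondegenerate : B.Nondegenerate
  invariant : ∀ x y z, B x ⁅y, z⁆ = B ⁅x, y⁆ z

/-- The quadratic Lie algebra with metric `B` is indecomposable: the only ideals on which `B` is
non-degenerate are `0` and the whole algebra. -/
def IsIndecomposable {F L : Type*} [Field F] [LieRing L] [LieAlgebra F L]
    (B : LinearMap.BilinForm F L) : Prop :=
  ∀ I : LieIdeal F L, (B.restrict I.toSubmodule).Nondegenerate → I = ⊥ ∨ I = ⊤

/-- A non-degenerate alternating bilinear form (alternating is the same as skew-symmetric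
whenever `2 ≠ 0`). -/
structure SymplecticForm (F V : Type*) [Field F] [AddCommGroup V] [Module F V] where
  form : LinearMap.BilinForm F V
  alt : ∀ u, form u u = 0
  nondegenerate : form.Nondegenerate

/-- The Heisenberg Lie algebra `V ⊕ F ħ` of a symplectic form: `vec` is the component in `V` and
`cen` the coefficient of `ħ`. -/
@[ext] structure Heisenberg {F V : Type*} [Field F] [AddCommGroup V] [Module F V]
    (ω : SymplecticForm F V) where
  vec : V
  cen : F

/-- The invertible linear maps of `V` that are skew with respect to `ω`. Extended by `ħ ↦ 0`, they
are the linear maps `φ` of the Heisenberg Lie algebra with `φ ħ = 0`, `φ V ⊆ V`, `φ` invertible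
on `V` and `φ ∈ 𝔬(ω)`. -/
structure SkewAut {F V : Type*} [Field F] [AddCommGroup V] [Module F V]
    (ω : SymplecticForm F V) where
  map : V ≃ₗ[F] V
  skew : ∀ u v, ω.form (map u) v = -ω.form u (map v)

section heisenberg

variable {F V : Type*} [Field F] [AddCommGroup V] [Module F V]

theorem SymplecticForm.swap (ω : SymplecticForm F V) (u v : V) :
    ω.form u v = -ω.form v u := by
  have h := ω.alt (u + v)
  simp only [map_add, LinearMap.add_apply, ω.alt, zero_add, add_zero] at h
  linear_combination h

namespace Heisenberg

variable {ω : SymplecticForm F V}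

/-- The underlying vector space of the Heisenberg Lie algebra is `V × F`. -/
def toProd : Heisenberg ω ≃ V × F where
  toFun x := (x.vec, x.cen)
  invFun x := ⟨x.1, x.2⟩
  left_inv _ := rfl
  right_inv _ := rfl

instance : AddCommGroup (Heisenberg ω) := toProd.addCommGroup

instance : Module F (Heisenberg ω) := toProd.module F

@[simp] theorem vec_zero : (0 : Heisenberg ω).vec = 0 := rfl
@[simp] theorem cen_zero : (0 : Heisenberg ω).cen = 0 := rfl
@[simp] theorem vec_add (x y : Heisenberg ω) : (x + y).vec = x.vec + y.vec := rfl
@[simp] theorem cen_add (x y : Heisenberg ω) : (x + y).cen = x.cen + y.cen := rfl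
@[simp] theorem vec_neg (x : Heisenberg ω) : (-x).vec = -x.vec := rfl
@[simp] theorem cen_neg (x : Heisenberg ω) : (-x).cen = -x.cen := rfl
@[simp] theorem vec_sub (x y : Heisenberg ω) : (x - y).vec = x.vec - y.vec := rfl
@[simp] theorem cen_sub (x y : Heisenberg ω) : (x - y).cen = x.cen - y.cen := rfl
@[simp] theorem vec_smul (t : F) (x : Heisenberg ω) : (t • x).vec = t • x.vec := rfl
@[simp] theorem cen_smul (t : F) (x : Heisenberg ω) : (t • x).cen = t * x.cen := rfl

/-- `⁅u + γ ħ, v + δ ħ⁆ = ω(u, v) ħ`. -/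
instance : Bracket (Heisenberg ω) (Heisenberg ω) where
  bracket x y := ⟨0, ω.form x.vec y.vec⟩

@[simp] theorem vec_lie (x y : Heisenberg ω) : ⁅x, y⁆.vec = 0 := rfl
@[simp] theorem cen_lie (x y : Heisenberg ω) : ⁅x, y⁆.cen = ω.form x.vec y.vec := rfl

instance : LieRing (Heisenberg ω) where
  add_lie _ _ _ := by ext <;> simp
  lie_add _ _ _ := by ext <;> simp
  lie_self _ := by ext <;> simp [ω.alt]
  leibniz_lie _ _ _ := by ext <;> simp

instance : LieAlgebra F (Heisenberg ω) where
  lie_smul _ _ _ := by ext <;> simp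

end Heisenberg

/-- The Heisenberg Lie algebra extended by `φ`, with underlying vector space `F φ ⊕ V ⊕ F ħ`:
`der` is the coefficient of `φ`, `vec` the component in `V` and `cen` the coefficient of `ħ`. -/
@[ext] structure HeisenbergExt {ω : SymplecticForm F V} (φ : SkewAut ω) where
  der : F
  vec : V
  cen : F

namespace HeisenbergExt

variable {ω : SymplecticForm F V} {φ : SkewAut ω}

/-- The underlying vector space is `F × V × F`. -/
def toProd : HeisenbergExt φ ≃ F × V × F where
  toFun x := (x.der, x.vec, x.cen)
  invFun x := ⟨x.1, x.2.1, x.2.2⟩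
  left_inv _ := rfl
  right_inv _ := rfl

instance : AddCommGroup (HeisenbergExt φ) := toProd.addCommGroup

instance : Module F (HeisenbergExt φ) := toProd.module F

@[simp] theorem der_zero : (0 : HeisenbergExt φ).der = 0 := rfl
@[simp] theorem der_add (x y : HeisenbergExt φ) : (x + y).der = x.der + y.der := rfl
@[simp] theorem der_smul (t : F) (x : HeisenbergExt φ) : (t • x).der = t • x.der := rfl
@[simp] theorem vec_zero : (0 : HeisenbergExt φ).vec = 0 := rfl
@[simp] theorem vec_add (x y : HeisenbergExt φ) : (x + y).vec = x.vec + y.vec := rfl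
@[simp] theorem vec_smul (t : F) (x : HeisenbergExt φ) : (t • x).vec = t • x.vec := rfl
@[simp] theorem cen_zero : (0 : HeisenbergExt φ).cen = 0 := rfl
@[simp] theorem cen_add (x y : HeisenbergExt φ) : (x + y).cen = x.cen + y.cen := rfl
@[simp] theorem cen_smul (t : F) (x : HeisenbergExt φ) : (t • x).cen = t • x.cen := rfl

/-- `⁅φ, u⁆ = φ u` and `⁅u, v⁆ = ω(u, v) ħ` for `u, v ∈ V`, and `ħ` is central. -/
instance : Bracket (HeisenbergExt φ) (HeisenbergExt φ) where
  bracket x y := ⟨0, x.der • φ.map y.vec - y.der • φ.map x.vec, ω.form x.vec y.vec⟩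

@[simp] theorem der_lie (x y : HeisenbergExt φ) : ⁅x, y⁆.der = 0 := rfl
@[simp] theorem vec_lie (x y : HeisenbergExt φ) :
    ⁅x, y⁆.vec = x.der • φ.map y.vec - y.der • φ.map x.vec := rfl
@[simp] theorem cen_lie (x y : HeisenbergExt φ) : ⁅x, y⁆.cen = ω.form x.vec y.vec := rfl

instance : LieRing (HeisenbergExt φ) where
  add_lie x y z := by
    ext
    · simp
    · simp only [vec_lie, vec_add, der_add, map_add, add_smul, smul_add]; abel
    · simp
  lie_add x y z := by
    ext
    · simp
    · simp only [vec_lie, vec_add, der_add, map_add, add_smul, smul_add]; abel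
    · simp
  lie_self x := by ext <;> simp [ω.alt]
  leibniz_lie x y z := by
    ext
    · simp
    · simp only [vec_lie, vec_add, der_lie, map_sub, map_smul, zero_smul, smul_sub, smul_smul,
        mul_comm]
      abel
    · simp only [cen_lie, cen_add, vec_lie, map_sub, map_smul, LinearMap.sub_apply,
        LinearMap.smul_apply, smul_eq_mul, φ.skew]
      rw [ω.swap y.vec (φ.map x.vec), φ.skew]
      ring

instance : LieAlgebra F (HeisenbergExt φ) where
  lie_smul t x y := by
    ext
    · simp
    · simp [smul_sub, smul_smul, mul_comm]
    · simp

variable (φ) in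
/-- The metric of the Heisenberg Lie algebra extended by `φ`: `B(u, v) = ω(φ⁻¹ u, v)` on `V`,
`B(φ, ħ) = 1`, and `B(u, φ) = B(u, ħ) = B(φ, φ) = B(ħ, ħ) = 0`. -/
def metric : LinearMap.BilinForm F (HeisenbergExt φ) :=
  LinearMap.mk₂ F
    (fun x y => ω.form (φ.map.symm x.vec) y.vec + x.der * y.cen + x.cen * y.der)
    (fun _ _ _ => by simp; ring) (fun _ _ _ => by simp; ring)
    (fun _ _ _ => by simp; ring) (fun _ _ _ => by simp; ring)

@[simp] theorem metric_apply (x y : HeisenbergExt φ) :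
    metric φ x y = ω.form (φ.map.symm x.vec) y.vec + x.der * y.cen + x.cen * y.der := rfl

theorem isInvariantMetric_metric : IsInvariantMetric (metric φ) := by
  have hsymm : ∀ u v, ω.form (φ.map.symm u) v = ω.form (φ.map.symm v) u := fun u v => by
    have h := φ.skew (φ.map.symm v) (φ.map.symm u)
    rw [φ.map.apply_symm_apply, φ.map.apply_symm_apply] at h
    rw [ω.swap, h, neg_neg]
  have hs : ∀ x y, metric φ x y = metric φ y x := fun x y => by
    simp only [metric_apply, hsymm x.vec y.vec]; ring
  have hl : ∀ x, (∀ y, metric φ x y = 0) → x = 0 := fun x h => by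
    ext
    · simpa using h ⟨0, 0, 1⟩
    · have h0 : φ.map.symm x.vec = 0 :=
        ω.nondegenerate.1 _ fun v => by simpa using h ⟨0, v, 0⟩
      simpa using h0
    · simpa using h ⟨1, 0, 0⟩
  refine ⟨hs, ⟨hl, fun y h => hl y fun x => by rw [hs]; exact h x⟩, fun x y z => ?_⟩
  simp only [metric_apply, vec_lie, der_lie, cen_lie, map_sub, map_smul, LinearMap.sub_apply,
    LinearMap.smul_apply, LinearEquiv.symm_apply_apply, smul_eq_mul]
  have h1 := φ.skew (φ.map.symm x.vec) z.vec
  have h2 := φ.skew (φ.map.symm x.vec) y.vec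
  rw [φ.map.apply_symm_apply] at h1 h2
  linear_combination y.der * h1 - z.der * h2

end HeisenbergExt

end heisenberg

/-! Write `N` for the nilradical, `J` for its orthogonal and `z` for the vector spanning the center
of `N`. Invariance makes `z` central in `L` (`lie_cen_eq_zero`), and `J ∩ N ⊆ F z`, since `J`
commutes with `N`. Everything reduces to `J ⊆ F z`.

If `L` is solvable, so is `J`; climbing its derived series, each term is nilpotent modulo the
central line `F z`, hence nilpotent, hence in `J ∩ N ⊆ F z` (`exists_smul_of_isSolvable`).

In characteristic zero, Cartan's criterion shows that the Killing form on `J` has its radical in `F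
z`, which forces `z ∉ ⁅J, J⁆` (`cen_notMem_lie_perp`). Then `⁅J, J⁆` is a non-degenerate ideal other
than `L`, so it vanishes by indecomposability, and the abelian ideal `J` lies in `N`.

Once `J ⊆ F z`, taking orthogonals gives `z^⊥ ⊆ N`. An isotropic `y` with `B y z = 1` then completes
`N` to `L`, and `φ` is the action of `y` on a copy of `V` orthogonal to `y`
(`exists_equiv_of_perp_le`). -/

section
variable {F L V : Type*} [Field F] [LieRing L] [LieAlgebra F L] [AddCommGroup V] [Module F V]
  {B : LinearMap.BilinForm F L} {ω : SymplecticForm F V}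

/-- A linear map `i : V → L` and a vector `z` identifying the Heisenberg algebra of `ω` with the
nilradical of `L`. -/
structure IsNilradicalFrame (ω : SymplecticForm F V) (i : V →ₗ[F] L) (z : L) : Prop where
  lie_vec : ∀ u v, ⁅i u, i v⁆ = ω.form u v • z
  lie_cen : ∀ u, ⁅i u, z⁆ = 0
  inj : ∀ u (c : F), i u + c • z = 0 → u = 0 ∧ c = 0
  mem_iff : ∀ x, x ∈ lieNilradical F L ↔ ∃ u, ∃ c : F, x = i u + c • z

theorem exists_isNilradicalFrame (f : lieNilradical F L ≃ₗ⁅F⁆ Heisenberg ω) :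
    ∃ (i : V →ₗ[F] L) (z : L), IsNilradicalFrame ω i z := by
  let g : Heisenberg ω →ₗ⁅F⁆ L := (lieNilradical F L).incl.comp f.symm.toLieHom
  have hg : Function.Injective g := fun x y h => f.symm.injective (Subtype.ext h)
  let i : V →ₗ[F] L :=
    { toFun := fun u => g ⟨u, 0⟩
      map_add' := fun u v => by rw [← map_add]; congr 1; ext <;> simp
      map_smul' := fun c u => by
        rw [RingHom.id_apply, ← map_smul]; congr 1; ext <;> simp }
  have hi : ∀ u, i u = g ⟨u, 0⟩ := fun _ => rfl
  have key : ∀ u (c : F), i u + c • g ⟨0, 1⟩ = g ⟨u, c⟩ := fun u c => by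
    rw [hi, ← map_smul, ← map_add]; congr 1; ext <;> simp
  refine ⟨i, g ⟨0, 1⟩, ⟨fun u v => ?_, fun u => ?_, fun u c h => ?_, fun x => ⟨fun hx => ?_, ?_⟩⟩⟩
  · rw [hi, hi, ← LieHom.map_lie, ← map_smul]; congr 1; ext <;> simp
  · rw [hi, ← LieHom.map_lie, ← map_zero g]; congr 1; ext <;> simp
  · rw [key, ← map_zero g] at h
    have := hg h
    exact ⟨congrArg Heisenberg.vec this, congrArg Heisenberg.cen this⟩
  · refine ⟨(f ⟨x, hx⟩).vec, (f ⟨x, hx⟩).cen, ?_⟩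
    rw [key]
    change x = ((f.symm (f ⟨x, hx⟩) : lieNilradical F L) : L)
    simp
  · rintro ⟨u, c, rfl⟩
    rw [key]
    exact (f.symm ⟨u, c⟩).2

/-- An ideal whose elements `x` all satisfy `⁅x, ⁅x, y⁆⁆ = 0` on the ideal lies in the
nilradical. -/
theorem le_lieNilradical_of_lie_lie_eq_zero [FiniteDimensional F L] (I : LieIdeal F L)
    (h : ∀ x ∈ I, ∀ y ∈ I, ⁅x, ⁅x, y⁆⁆ = 0) : I ≤ lieNilradical F L := by
  refine le_sSup ?_
  change LieRing.IsNilpotent I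
  -- Engel's theorem: it is enough that each `ad x` on `I` is nilpotent.
  rw [LieAlgebra.isNilpotent_iff_forall (R := F)]
  intro x
  refine ⟨2, ?_⟩
  ext y
  simpa [pow_two] using h x x.2 y y.2

theorem le_lieNilradical_of_abelian [FiniteDimensional F L] (I : LieIdeal F L)
    (h : ∀ x ∈ I, ∀ y ∈ I, ⁅x, y⁆ = 0) : I ≤ lieNilradical F L :=
  le_lieNilradical_of_lie_lie_eq_zero I fun x hx y hy => by rw [h x hx y hy, lie_zero]

/-! ### Orthogonals of ideals -/

namespace IsInvariantMetric

theorem lieInvariant (hB : IsInvariantMetric B) : B.lieInvariant L := fun x y z => by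
  rw [hB.invariant y x z, ← lie_skew x y, map_neg, LinearMap.neg_apply]

theorem isRefl (hB : IsInvariantMetric B) : B.IsRefl := fun x y h => by rw [hB.symm, h]

/-- The orthogonal ideal of an ideal. -/
def perp (hB : IsInvariantMetric B) (I : LieIdeal F L) : LieIdeal F L :=
  LieAlgebra.InvariantForm.orthogonal B hB.lieInvariant I

theorem mem_perp (hB : IsInvariantMetric B) {I : LieIdeal F L} {x : L} :
    x ∈ hB.perp I ↔ ∀ y ∈ I, B y x = 0 :=
  LieAlgebra.InvariantForm.mem_orthogonal B hB.lieInvariant I x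

theorem eq_zero (hB : IsInvariantMetric B) {x : L} (h : ∀ y, B x y = 0) : x = 0 :=
  hB.nondegenerate.1 x h

/-- An ideal commutes with its orthogonal. -/
theorem lie_eq_zero_of_mem_perp (hB : IsInvariantMetric B) {I : LieIdeal F L} {x y : L}
    (hx : x ∈ hB.perp I) (hy : y ∈ I) : ⁅x, y⁆ = 0 :=
  hB.eq_zero fun l => by
    rw [← hB.invariant, hB.symm]
    exact hB.mem_perp.1 hx _ (lie_mem_left F L I y l hy)

end IsInvariantMetric

/-! ### The center of the nilradical -/

namespace IsNilradicalFrame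

variable {i : V →ₗ[F] L} {z : L}

theorem ne_zero (h : IsNilradicalFrame ω i z) : z ≠ 0 := fun hz =>
  one_ne_zero (h.inj 0 1 (by simp [hz])).2

theorem vec_mem (h : IsNilradicalFrame ω i z) (u : V) : i u ∈ lieNilradical F L :=
  (h.mem_iff _).2 ⟨u, 0, by simp⟩

theorem cen_mem (h : IsNilradicalFrame ω i z) : z ∈ lieNilradical F L :=
  (h.mem_iff _).2 ⟨0, 1, by simp⟩

theorem exists_form_eq_one [Nontrivial V] (ω : SymplecticForm F V) :
    ∃ u v, ω.form u v = 1 := by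
  obtain ⟨u, hu⟩ := exists_ne (0 : V)
  have : ∃ v, ω.form u v ≠ 0 := by
    by_contra! hc
    exact hu (ω.nondegenerate.1 u hc)
  obtain ⟨v, hv⟩ := this
  exact ⟨u, (ω.form u v)⁻¹ • v, by simp [hv]⟩

/-- An element of the nilradical commuting with the nilradical is a multiple of `z`. -/
theorem exists_smul_of_lie_eq_zero (h : IsNilradicalFrame ω i z) {x : L}
    (hx : x ∈ lieNilradical F L) (hc : ∀ v, ⁅x, i v⁆ = 0) : ∃ c : F, x = c • z := by
  obtain ⟨u, c, rfl⟩ := (h.mem_iff x).1 hx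
  have hu : u = 0 := ω.nondegenerate.1 u fun v => by
    have h1 := hc v
    rw [add_lie, h.lie_vec, smul_lie, ← lie_skew, h.lie_cen, neg_zero, smul_zero, add_zero] at h1
    exact (smul_eq_zero.1 h1).resolve_right h.ne_zero
  exact ⟨c, by simp [hu]⟩

/-- By the Jacobi identity, the center of an ideal is stable under all of `L`. -/
theorem lie_mem_span (h : IsNilradicalFrame ω i z) (x : L) : ∃ c : F, ⁅x, z⁆ = c • z := by
  refine h.exists_smul_of_lie_eq_zero (lie_mem_right F L _ x z h.cen_mem) fun v => ?_
  obtain ⟨u, c, hu⟩ := (h.mem_iff _).1 (lie_mem_right F L _ x _ (h.vec_mem v))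
  have hz : ⁅z, i v⁆ = 0 := by rw [← lie_skew, h.lie_cen, neg_zero]
  rw [lie_lie, hz, lie_zero, zero_sub, hu, lie_add, lie_smul, lie_self, ← lie_skew, h.lie_cen]
  simp

/-- The center of the nilradical is orthogonal to the nilradical. -/
theorem form_cen_vec (h : IsNilradicalFrame ω i z) (hB : IsInvariantMetric B)
    (hF : (2 : F) ≠ 0) (u : V) : B z (i u) = 0 := by
  by_cases hu : u = 0
  · simp [hu]
  have : ∃ v, ω.form u v ≠ 0 := by
    by_contra! hc
    exact hu (ω.nondegenerate.1 u hc)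
  obtain ⟨v, hv⟩ := this
  -- The two sides are `-ω(u, v) B(z, i u)` and `ω(u, v) B(z, i u)`, so characteristic not 2 is
  -- needed.
  have h1 := hB.invariant (i u) (i v) (i u)
  rw [h.lie_vec, h.lie_vec, map_smul, map_smul, LinearMap.smul_apply, hB.symm (i u) z,
    ω.swap v u, smul_eq_mul, smul_eq_mul] at h1
  have h2 : (2 * ω.form u v) * B z (i u) = 0 := by linear_combination -h1
  exact (mul_eq_zero.1 h2).resolve_left (mul_ne_zero hF hv)

theorem form_cen_cen [Nontrivial V] (h : IsNilradicalFrame ω i z) (hB : IsInvariantMetric B) :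
    B z z = 0 := by
  obtain ⟨u, v, huv⟩ := exists_form_eq_one ω
  have h1 := hB.invariant (i u) (i v) z
  rwa [h.lie_vec, h.lie_cen, map_zero, huv, one_smul, eq_comm] at h1

theorem cen_mem_perp [Nontrivial V] (h : IsNilradicalFrame ω i z) (hB : IsInvariantMetric B)
    (hF : (2 : F) ≠ 0) : z ∈ hB.perp (lieNilradical F L) := hB.mem_perp.2 fun y hy => by
  obtain ⟨u, c, rfl⟩ := (h.mem_iff y).1 hy
  simp [hB.symm (i u) z, h.form_cen_vec hB hF, h.form_cen_cen hB]

theorem exists_form_cen_eq_one (h : IsNilradicalFrame ω i z) (hB : IsInvariantMetric B) :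
    ∃ y, B y z = 1 := by
  have : ∃ y, B z y ≠ 0 := by
    by_contra! hc
    exact h.ne_zero (hB.eq_zero hc)
  obtain ⟨y, hy⟩ := this
  exact ⟨(B z y)⁻¹ • y, by simp [hB.symm y z, hy]⟩

/-- Write `⁅x, z⁆ = c(x) z` and pair with `y` such that `B y z = 1`. Then `c(y) = B(⁅y, y⁆, z) = 0`,
and `c(x) = -B(⁅x, y⁆, z) = -B(x, ⁅y, z⁆) = -c(y) B(x, z) = 0`. -/
theorem lie_cen_eq_zero (h : IsNilradicalFrame ω i z) (hB : IsInvariantMetric B) (x : L) :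
    ⁅x, z⁆ = 0 := by
  obtain ⟨y, hy⟩ := h.exists_form_cen_eq_one hB
  obtain ⟨a, ha⟩ := h.lie_mem_span y
  obtain ⟨c, hc⟩ := h.lie_mem_span x
  have h1 : a = 0 := by
    have := hB.invariant y y z
    rwa [ha, lie_self, map_smul, hy, map_zero, LinearMap.zero_apply, smul_eq_mul, mul_one] at this
  have h2 : c = 0 := by
    have e1 := hB.invariant y x z
    have e2 := hB.invariant x y z
    rw [hc, map_smul, hy, ← lie_skew, map_neg, LinearMap.neg_apply, ← e2, ha, h1] at e1
    simpa using e1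
  rw [hc, h2, zero_smul]

theorem exists_smul_of_mem_perp (h : IsNilradicalFrame ω i z) (hB : IsInvariantMetric B) {x : L}
    (hx : x ∈ lieNilradical F L) (hp : x ∈ hB.perp (lieNilradical F L)) : ∃ c : F, x = c • z :=
  h.exists_smul_of_lie_eq_zero hx fun v => hB.lie_eq_zero_of_mem_perp hp (h.vec_mem v)

end IsNilradicalFrame

/-- A functional vanishing on the radical of a bilinear form is represented by a vector. -/
theorem LinearMap.BilinForm.exists_forall_apply_eq {W : Type*} [AddCommGroup W] [Module F W]
    [FiniteDimensional F W] (β : LinearMap.BilinForm F W) (l : W →ₗ[F] F)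
    (h : ∀ x, β x = 0 → l x = 0) : ∃ w, ∀ x, β x w = l x := by
  -- The range of a transpose is the annihilator of the kernel; reflexivity of `W` then turns a
  -- preimage into a vector.
  have hl : l ∈ LinearMap.range (LinearMap.dualMap β) := by
    rw [LinearMap.range_dualMap_eq_dualAnnihilator_ker, Submodule.mem_dualAnnihilator]
    exact fun x hx => h x hx
  obtain ⟨g, hg⟩ := hl
  refine ⟨(Module.evalEquiv F W).symm g, fun x => ?_⟩
  rw [← hg, LinearMap.dualMap_apply, Module.apply_evalEquiv_symm_apply]

/-! ### The orthogonal of the nilradical is contained in its center -/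

namespace IsNilradicalFrame

variable {i : V →ₗ[F] L} {z : L}

/-- An ideal inside the orthogonal of the nilradical that is solvable is contained in the center
of the nilradical. -/
theorem exists_smul_of_isSolvable [FiniteDimensional F L] (h : IsNilradicalFrame ω i z)
    (hB : IsInvariantMetric B) (I : LieIdeal F L) [hI : LieAlgebra.IsSolvable I]
    (hle : I ≤ hB.perp (lieNilradical F L)) {x : L} (hx : x ∈ I) : ∃ c : F, x = c • z := by
  obtain ⟨n, hn⟩ := hI.solvable F
  rw [LieIdeal.derivedSeries_eq_bot_iff] at hn
  -- If the next derived ideal lies in the central line `F z`, this one satisfies `⁅a, ⁅a, b⁆⁆ = 0`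
  -- and so lies in the nilradical.
  have step : ∀ k, (∀ x ∈ LieAlgebra.derivedSeriesOfIdeal F L (k + 1) I, ∃ c : F, x = c • z) →
      ∀ x ∈ LieAlgebra.derivedSeriesOfIdeal F L k I, ∃ c : F, x = c • z := fun k hk x hx => by
    refine h.exists_smul_of_mem_perp hB ?_
      (hle (LieAlgebra.derivedSeriesOfIdeal_le_self I k hx))
    refine le_lieNilradical_of_lie_lie_eq_zero _ (fun a ha b hb => ?_) hx
    obtain ⟨c, hc⟩ := hk ⁅a, b⁆ (by
      rw [LieAlgebra.derivedSeriesOfIdeal_succ]; exact LieSubmodule.lie_mem_lie ha hb)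
    rw [hc, lie_smul, h.lie_cen_eq_zero hB, smul_zero]
  have all : ∀ k ≤ n, ∀ x ∈ LieAlgebra.derivedSeriesOfIdeal F L (n - k) I,
      ∃ c : F, x = c • z := fun k => by
    induction k with
    | zero => exact fun _ x hx => ⟨0, by rw [Nat.sub_zero, hn] at hx; simpa using hx⟩
    | succ k ih =>
      intro hk
      apply step
      rw [show n - (k + 1) + 1 = n - k by omega]
      exact ih (by omega)
  have := all n le_rfl x
  rw [Nat.sub_self, LieAlgebra.derivedSeriesOfIdeal_zero] at this
  exact this hx

theorem killingForm_cen (h : IsNilradicalFrame ω i z) (hB : IsInvariantMetric B) (x : L) :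
    killingForm F L z x = 0 := by
  have : LieAlgebra.ad F L z = 0 := by
    ext y
    rw [LieAlgebra.ad_apply, ← lie_skew, h.lie_cen_eq_zero hB]
    simp
  rw [killingForm_apply_apply, this, LinearMap.zero_comp, map_zero]

/-- In characteristic zero, the Killing form restricted to the orthogonal of the nilradical has
the center of the nilradical as its radical. -/
theorem exists_smul_of_killingForm_eq_zero [CharZero F] [FiniteDimensional F L]
    (h : IsNilradicalFrame ω i z) (hB : IsInvariantMetric B) {x : L}
    (hx : x ∈ hB.perp (lieNilradical F L))
    (hk : ∀ y ∈ hB.perp (lieNilradical F L), killingForm F L x y = 0) : ∃ c : F, x = c • z := by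
  set J := hB.perp (lieNilradical F L)
  -- This is the radical of the Killing form on `J`, solvable by Cartan's criterion.
  let K : LieIdeal F L := J ⊓ J.killingCompl
  have hK : LieAlgebra.IsSolvable K := by
    refine LieIdeal.isSolvable_of_killingForm_apply_lie_eq_zero K fun a ha b hb => ?_
    have hb' : b ∈ K := LieSubmodule.lie_le_left K K hb
    exact LieIdeal.mem_killingCompl F L J |>.1 hb'.2 a ha.1
  refine h.exists_smul_of_isSolvable hB K inf_le_left ⟨hx, ?_⟩
  refine (LieIdeal.mem_killingCompl F L J).2 fun y hy => ?_
  rw [LieModule.traceForm_comm]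
  exact hk y hy

/-- Correcting `y` by a suitable `w ∈ J` makes `y - w` Killing-orthogonal to `J`. Then `⁅y - w, J⁆`
lies in the Killing radical of `J`, hence in `F z`, which is `B`-orthogonal to `J`. By invariance `y
- w` is `B`-orthogonal to `⁅J, J⁆`, whereas `B(y - w, z) = 1`. -/
theorem cen_notMem_lie_perp [CharZero F] [FiniteDimensional F L] [Nontrivial V]
    (h : IsNilradicalFrame ω i z) (hB : IsInvariantMetric B) :
    z ∉ (⁅hB.perp (lieNilradical F L), hB.perp (lieNilradical F L)⁆ : LieIdeal F L) := by
  have hJz : ∀ x ∈ hB.perp (lieNilradical F L), B z x = 0 := fun x hx =>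
    hB.mem_perp.1 hx z h.cen_mem
  have hzJ := h.cen_mem_perp hB two_ne_zero
  have hker := fun x hx => h.exists_smul_of_killingForm_eq_zero hB (x := x) hx
  set J := hB.perp (lieNilradical F L)
  obtain ⟨y, hy⟩ := h.exists_form_cen_eq_one hB
  obtain ⟨w, hw⟩ := ((killingForm F L).restrict J.toSubmodule).exists_forall_apply_eq
    ((killingForm F L y).domRestrict J.toSubmodule) (fun x hx => by
      obtain ⟨c, hc⟩ := hker x x.2 fun a ha => LinearMap.congr_fun hx ⟨a, ha⟩
      rw [LinearMap.domRestrict_apply, hc, map_smul, LieModule.traceForm_comm,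
        h.killingForm_cen hB, smul_zero])
  have hv : ∀ x ∈ J, killingForm F L (y - w) x = 0 := fun x hx => by
    have h1 : killingForm F L x w = killingForm F L y x := hw ⟨x, hx⟩
    rw [map_sub, LinearMap.sub_apply, ← h1, LieModule.traceForm_comm, sub_self]
  have hlie : ∀ a ∈ J, ∃ c : F, ⁅y - w, a⁆ = c • z := fun a ha => by
    refine hker _ (lie_mem_right F L J _ _ ha) fun b hb => ?_
    rw [LieModule.traceForm_apply_lie_apply]
    exact hv _ (lie_mem_right F L J _ _ hb)
  have hle : ∀ x ∈ (⁅J, J⁆ : LieIdeal F L), B (y - w) x = 0 := fun x hx => by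
    rw [← LieSubmodule.mem_toSubmodule, LieSubmodule.lieIdeal_oper_eq_linear_span'] at hx
    induction hx using Submodule.span_induction with
    | mem x hx =>
      obtain ⟨a, ha, b, hb, rfl⟩ := hx
      obtain ⟨c, hc⟩ := hlie a ha
      rw [hB.invariant, hc, map_smul, LinearMap.smul_apply, hJz b hb, smul_zero]
    | zero => simp
    | add a b _ _ ha hb => rw [map_add, ha, hb, add_zero]
    | smul c a _ ha => rw [map_smul, ha, smul_zero]
  intro hz
  have h1 := hle z hz
  rw [map_sub, LinearMap.sub_apply, hy, hB.symm, hJz w w.2, sub_zero] at h1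
  exact one_ne_zero h1

/-- If the metric is indecomposable in characteristic zero, then the orthogonal of the nilradical
is the center of the nilradical. -/
theorem exists_smul_of_isIndecomposable [CharZero F] [FiniteDimensional F L] [Nontrivial V]
    (h : IsNilradicalFrame ω i z) (hB : IsInvariantMetric B) (hind : IsIndecomposable B) {x : L}
    (hx : x ∈ hB.perp (lieNilradical F L)) : ∃ c : F, x = c • z := by
  have hzS := h.cen_notMem_lie_perp hB
  have hsm := fun x => h.exists_smul_of_mem_perp hB (x := x)
  have hzJ := h.cen_mem_perp hB two_ne_zero
  set J := hB.perp (lieNilradical F L)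
  set S : LieIdeal F L := ⁅J, J⁆
  have hSJ : S ≤ J := LieSubmodule.lie_le_left J J
  -- `S ∩ S^⊥` is an abelian ideal, so it lies in `N ∩ J ⊆ F z`; since `z ∉ S`, it is zero.
  have hcap : ∀ a ∈ S, a ∈ hB.perp S → a = 0 := fun a ha hp => by
    have hN : S ⊓ hB.perp S ≤ lieNilradical F L :=
      le_lieNilradical_of_abelian _ fun b hb c hc => hB.lie_eq_zero_of_mem_perp hb.2 hc.1
    obtain ⟨c, hc⟩ := hsm a (hN ⟨ha, hp⟩) (hSJ ha)
    by_cases h0 : c = 0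
    · rw [hc, h0, zero_smul]
    · refine absurd ?_ hzS
      have := S.smul_mem c⁻¹ ha
      rwa [hc, inv_smul_smul₀ h0] at this
  have hnd : (B.restrict S.toSubmodule).Nondegenerate := by
    refine B.nondegenerate_restrict_of_disjoint_orthogonal hB.isRefl ?_
    rw [Submodule.disjoint_def]
    exact fun a ha hp => hcap a ha hp
  rcases hind S hnd with h0 | h1
  · refine hsm x ?_ hx
    refine le_lieNilradical_of_abelian J (fun a ha b hb => ?_) hx
    have : ⁅a, b⁆ ∈ S := LieSubmodule.lie_mem_lie ha hb
    rw [h0] at this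
    simpa using this
  · exact absurd (h1 ▸ LieSubmodule.mem_top z) hzS

end IsNilradicalFrame

/-! ### Reconstruction of the algebra and its metric -/

/-- Recognition of the Heisenberg Lie algebra extended by a derivation, with its metric. -/
theorem exists_equiv_heisenbergExt (hB : IsInvariantMetric B) (φ : SkewAut ω) (j : V →ₗ[F] L)
    {y z : L} (hyj : ∀ u, ⁅y, j u⁆ = j (φ.map u)) (hjj : ∀ u v, ⁅j u, j v⁆ = ω.form u v • z)
    (hz : ∀ x : L, ⁅x, z⁆ = 0) (hyy : B y y = 0) (hyz : B y z = 1) (hzz : B z z = 0)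
    (hBj : ∀ u, B y (j u) = 0) (hBz : ∀ u, B z (j u) = 0)
    (hspan : ∀ x, ∃ (a : F) (u : V) (c : F), x = a • y + j u + c • z) :
    ∃ e : L ≃ₗ⁅F⁆ HeisenbergExt φ, ∀ x y, HeisenbergExt.metric φ (e x) (e y) = B x y := by
  have hz' : ∀ x : L, ⁅z, x⁆ = 0 := fun x => by rw [← lie_skew, hz, neg_zero]
  have hjy : ∀ u, ⁅j u, y⁆ = -j (φ.map u) := fun u => by rw [← lie_skew, hyj]
  let g : HeisenbergExt φ →ₗ⁅F⁆ L :=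
    { toFun := fun x => x.der • y + j x.vec + x.cen • z
      map_add' := fun p q => by
        simp only [HeisenbergExt.der_add, HeisenbergExt.vec_add, HeisenbergExt.cen_add, add_smul,
          map_add]
        abel
      map_smul' := fun c p => by
        simp only [HeisenbergExt.der_smul, HeisenbergExt.vec_smul, HeisenbergExt.cen_smul,
          smul_assoc, map_smul, smul_add, RingHom.id_apply]
      map_lie' := fun {p q} => by
        simp only [HeisenbergExt.der_lie, HeisenbergExt.vec_lie, HeisenbergExt.cen_lie, add_lie,
          lie_add, smul_lie, lie_smul, hz, hz', hyj, hjy, hjj, lie_self, map_sub, map_smul,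
          smul_zero, zero_smul]
        module }
  have hg : ∀ p, g p = p.der • y + j p.vec + p.cen • z := fun _ => rfl
  have hjB : ∀ u v, B (j u) (j v) = ω.form (φ.map.symm u) v := fun u v => by
    obtain ⟨u, rfl⟩ := φ.map.surjective u
    rw [← hyj, ← hB.invariant, hjj, map_smul, hyz, φ.map.symm_apply_apply, smul_eq_mul, mul_one]
  have hiso : ∀ p q, B (g p) (g q) = HeisenbergExt.metric φ p q := fun p q => by
    rw [hg, hg, HeisenbergExt.metric_apply]
    simp only [map_add, map_smul, LinearMap.add_apply, LinearMap.smul_apply, smul_eq_mul, hyy,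
      hyz, hzz, hBj, hBz, hjB, hB.symm _ y, hB.symm _ z]
    ring
  -- An isometry out of a non-degenerate space is injective.
  have hinj : Function.Injective g := by
    refine (injective_iff_map_eq_zero g).2 fun p hp => ?_
    refine HeisenbergExt.isInvariantMetric_metric.eq_zero fun q => ?_
    rw [← hiso, hp, map_zero, LinearMap.zero_apply]
  have hsurj : Function.Surjective g := fun x => by
    obtain ⟨a, u, c, rfl⟩ := hspan x
    exact ⟨⟨a, u, c⟩, rfl⟩
  let e := LieEquiv.ofBijective g ⟨hinj, hsurj⟩
  refine ⟨e.symm, fun p q => ?_⟩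
  rw [← hiso]
  congr 1
  · congr 1
    exact e.apply_symm_apply p
  · exact e.apply_symm_apply q

namespace IsNilradicalFrame

variable {i : V →ₗ[F] L} {z : L}

/-- If the orthogonal of the nilradical is the center of the nilradical, then the algebra is the
Heisenberg Lie algebra extended by a derivation. -/
theorem exists_equiv_of_perp_le [FiniteDimensional F L] [FiniteDimensional F V] [Nontrivial V]
    (h : IsNilradicalFrame ω i z) (hB : IsInvariantMetric B) (hF : (2 : F) ≠ 0)
    (hJ : ∀ x ∈ hB.perp (lieNilradical F L), ∃ c : F, x = c • z) :
    ∃ (φ : SkewAut ω) (e : L ≃ₗ⁅F⁆ HeisenbergExt φ),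
      ∀ x y, HeisenbergExt.metric φ (e x) (e y) = B x y := by
  have hz := h.lie_cen_eq_zero hB
  have hzz := h.form_cen_cen hB
  have hzi := h.form_cen_vec hB hF
  obtain ⟨y, hyz, hyy⟩ : ∃ y, B y z = 1 ∧ B y y = 0 := by
    obtain ⟨y, hy⟩ := h.exists_form_cen_eq_one hB
    -- Subtracting `t z` changes `B y y` by `-2t`.
    refine ⟨y - (B y y / 2) • z, by simp [hy, hzz], ?_⟩
    simp only [map_sub, map_smul, LinearMap.sub_apply, LinearMap.smul_apply, smul_eq_mul, hy, hzz,
      hB.symm z y]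
    field_simp
    ring
  -- The copy of `V` is shifted along `z` to become orthogonal to `y`; brackets are unchanged
  -- because `z` is central.
  let j : V →ₗ[F] L := i - (B y ∘ₗ i).smulRight z
  have hj : ∀ u, j u = i u - B y (i u) • z := fun _ => rfl
  have hBj : ∀ u, B y (j u) = 0 := fun u => by simp [hj, hyz]
  have hBz : ∀ u, B z (j u) = 0 := fun u => by simp [hj, hzi, hzz]
  have hjj : ∀ u v, ⁅j u, j v⁆ = ω.form u v • z := fun u v => by
    have hz' : ⁅z, i v⁆ = 0 := by rw [← lie_skew, hz, neg_zero]
    simp [hj, hz, hz', h.lie_vec]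
  have hjmem : ∀ x ∈ lieNilradical F L, ∃ u, ∃ c : F, x = j u + c • z := fun x hx => by
    obtain ⟨u, c, rfl⟩ := (h.mem_iff x).1 hx
    exact ⟨u, c + B y (i u), by rw [hj, add_smul]; abel⟩
  have hjN : ∀ u, j u ∈ lieNilradical F L := fun u =>
    (h.mem_iff _).2 ⟨u, -B y (i u), by rw [hj, neg_smul, sub_eq_add_neg]⟩
  have hjinj : Function.Injective j := by
    refine (injective_iff_map_eq_zero j).2 fun u hu => (h.inj u (-B y (i u)) ?_).1
    rw [← hu, hj, neg_smul, sub_eq_add_neg]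
  -- The `z`-component of `⁅y, j u⁆` is `B(y, ⁅y, j u⁆) = B(⁅y, y⁆, j u) = 0`.
  have hex : ∀ u, ∃ v, ⁅y, j u⁆ = j v := fun u => by
    obtain ⟨v, c, hv⟩ := hjmem _ (lie_mem_right F L _ y _ (hjN u))
    refine ⟨v, ?_⟩
    have h1 := hB.invariant y y (j u)
    rw [hv, lie_self, map_add, map_smul, hBj, hyz, map_zero, LinearMap.zero_apply, zero_add,
      smul_eq_mul, mul_one] at h1
    rw [hv, h1, zero_smul, add_zero]
  choose d hd using hex
  let D : V →ₗ[F] V :=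
    { toFun := d
      map_add' := fun u v => hjinj (by rw [← hd, map_add, map_add, lie_add, hd, hd])
      map_smul' := fun c u => hjinj (by rw [← hd, map_smul, map_smul, lie_smul, hd]; rfl) }
  -- Since `ω(u, v) = B(y, ⁅j u, j v⁆) = B(j (D u), j v)`, the kernel of `D` lies in the radical of
  -- `ω`.
  have hD : Function.Injective D := by
    refine (injective_iff_map_eq_zero D).2 fun u hu => ω.nondegenerate.1 u fun v => ?_
    have h1 := hB.invariant y (j u) (j v)
    rw [hjj, hd, map_smul, hyz, show d u = 0 from hu, map_zero, map_zero, LinearMap.zero_apply,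
      smul_eq_mul, mul_one] at h1
    exact h1
  let φ : SkewAut ω :=
    { map := LinearEquiv.ofInjectiveEndo D hD
      skew := fun u v => by
        -- Skewness is the Jacobi identity for `y`, `j u`, `j v`, whose left side vanishes because
        -- `z` is central.
        have h1 := leibniz_lie y (j u) (j v)
        rw [hjj, lie_smul, hz, hd, hd, hjj, hjj, smul_zero, ← add_smul] at h1
        exact eq_neg_of_add_eq_zero_left ((smul_eq_zero.1 h1.symm).resolve_right h.ne_zero) }
  -- `J ⊆ F z` gives `z^⊥ ⊆ J^⊥`, and `J^⊥ = N` by the double orthogonal.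
  have hperp : ∀ x, B x z = 0 → x ∈ lieNilradical F L := fun x hx => by
    rw [← LieSubmodule.mem_toSubmodule, ← LinearMap.BilinForm.orthogonal_orthogonal
      hB.nondegenerate hB.isRefl (lieNilradical F L).toSubmodule]
    intro n hn
    obtain ⟨c, hc⟩ := hJ n hn
    change B n x = 0
    rw [hc, map_smul, LinearMap.smul_apply, hB.symm, hx, smul_zero]
  refine ⟨φ, exists_equiv_heisenbergExt hB φ j hd hjj hz hyy hyz hzz hBj hBz fun x => ?_⟩
  obtain ⟨u, c, hu⟩ := hjmem (x - B x z • y) (hperp _ (by simp [hyz]))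
  exact ⟨B x z, u, c, by rw [add_assoc, ← hu]; abel⟩

end IsNilradicalFrame
end

theorem mainTheorem5 {F L V : Type*} [Field F] (hF : (2 : F) ≠ 0)
    [LieRing L] [LieAlgebra F L] [FiniteDimensional F L]
    (B : LinearMap.BilinForm F L) (hB : IsInvariantMetric B)
    [AddCommGroup V] [Module F V] (m : ℕ) (hm : 1 ≤ m) (hV : Module.finrank F V = 2 * m)
    (ω : SymplecticForm F V)
    (hNil : Nonempty (lieNilradical F L ≃ₗ⁅F⁆ Heisenberg ω)) :
    (CharZero F → IsIndecomposable B →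
      ∃ (φ : SkewAut ω) (e : L ≃ₗ⁅F⁆ HeisenbergExt φ),
        ∀ x y, HeisenbergExt.metric φ (e x) (e y) = B x y) ∧
    (LieAlgebra.IsSolvable L →
      ∃ (φ : SkewAut ω) (e : L ≃ₗ⁅F⁆ HeisenbergExt φ),
        ∀ x y, HeisenbergExt.metric φ (e x) (e y) = B x y) := by
  obtain ⟨f⟩ := hNil
  obtain ⟨i, z, h⟩ := exists_isNilradicalFrame f
  have hpos : 0 < Module.finrank F V := by omega
  have := Module.finite_of_finrank_pos hpos
  have := Module.nontrivial_of_finrank_pos hpos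
  exact ⟨fun _ hind => h.exists_equiv_of_perp_le hB hF fun _ hx =>
      h.exists_smul_of_isIndecomposable hB hind hx,
    fun _ => h.exists_equiv_of_perp_le hB hF fun _ hx =>
      h.exists_smul_of_isSolvable hB _ le_rfl hx⟩
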